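/- \textbf{Setting.} Let $\Omega_{2D}\subset\mathbb R^2$ be open and bounded, $\Omega_{2D,c}\subseteq\Omega_{2D}$ open, $d_{Fe}>0$, $d_-,d_+\ge 0$, and let $$\Omega=\Omega_{2D}\times\left(-\tfrac{d_{Fe}}2-d_-,\ \tfrac{d_{Fe}}2+d_+\right),\qquad \Omega_c=\Omega_{2D,c}\times\left(-\tfrac{d_{Fe}}2,\tfrac{d_{Fe}}2\right)$$ be the problem domain and the conducting sheet ($d_\pm$ is the thickness of the insulation above and below the sheet). Let $\omega\in\mathbb R$, let $\mu$ be a measurable, positive, bounded permeability on $\Omega$, let $\sigma$ be a measurable conductivity that is bounded and bounded away from $0$ on $\Omega_c$, let $\rho=\sigma^{-1}$ there, and let $H_{BS}\in L^2(\Omega)^3$ be complex valued. Put $\|J\|_\rho^2=\int_{\Omega_c}\rho\,J\cdot J^*$. All derivatives of non-smooth fields are weak ones, and all fields are complex valued. Fields in $H(\operatorname{curl},\Omega_c)$ are identified with their extensions by zero to $\Omega$, which are required to lie in $H(\operatorname{curl},\Omega)$ with curl zero outside $\Omega_c$ (so no condition is imposed on $\partial\Omega\cap\partial\Omega_c$);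 similarly for $H(\operatorname{curl}_{2D},\Omega_{2D,c})$, where $\operatorname{curl}_{2D}V=\partial_xV_y-\partial_yV_x$. \textbf{Exact solution.} Let $T\in H(\operatorname{curl},\Omega_c)$ and $\Phi\in H^1(\Omega)$ solve the eddy current problem $\operatorname{curl}\rho\operatorname{curl}T+i\omega\mu(T-\nabla\Phi+H_{BS})=0$, $\operatorname{div}\mu(T-\nabla\Phi+H_{BS})=0$ in weak form, that is, $$\int_{\Omega_c}\rho\operatorname{curl}T\cdot\operatorname{curl}v+\int_\Omega i\omega\mu(T-\nabla\Phi)\cdot(v-\nabla q)=-\int_\Omega i\omega\mu H_{BS}\cdot(v-\nabla q)$$ for all $v\in H(\operatorname{curl},\Omega_c)$ and $q\in H^1(\Omega)$. \textbf{2D/1D MSFEM field.} Let $T_0=\nabla\Phi_0$ with $\Phi_0\in H^1(\Omega_{2D})$, let $T_2\in H(\operatorname{curl}_{2D},\Omega_{2D,c})$, and let $$T_{2D/1D}(x,y,z)=\begin{pmatrix}\phi_0(z)T_{0,x}(x,y)+\phi_2(z)T_{2,x}(x,y)\\ \phi_0(z)T_{0,y}(x,y)+\phi_2(z)T_{2,y}(x,y)\\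 0\end{pmatrix},$$ where $\phi_0=1$, $\phi_2(z)=\frac12\sqrt{\frac32}\left((2z/d_{Fe})^2-1\right)$ for $|z|\le d_{Fe}/2$ and $\phi_2(z)=0$ otherwise. (This covers in particular every exact or discrete 2D/1D MSFEM approximation.) \textbf{Equilibrated flux.} Let $\gamma\in H(\operatorname{curl},\Omega)$ satisfy $$\operatorname{curl}\gamma=-i\omega\mu\,(T_{2D/1D}+H_{BS})\quad\text{in }\Omega,$$ together with the natural boundary conditions of the weak eddy current problem: $\operatorname{curl}\gamma\cdot n=0$ on $\partial\Omega$, in the sense that $\operatorname{curl}\gamma\in H_0(\operatorname{div},\Omega)$ (the closure of $C_c^\infty(\Omega)^3$ in $H(\operatorname{div},\Omega)$) with $\operatorname{div}\operatorname{curl}\gamma=0$, and $\gamma\times n=0$ on $\partial\Omega\cap\overline{\Omega_c}$, in the sense that $\gamma$ is the limit in $H(\operatorname{curl},\Omega)$ of fields in $C^\infty(\Omega)^3\cap H(\operatorname{curl},\Omega)$ each of which vanishes in a neighbourhood of $\partial\Omega\cap\overline{\Omega_c}$. \textbf{Theorem.} Then $T_{2D/1D}\in H(\operatorname{curl},\Omega)$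 with $\operatorname{curl}T_{2D/1D}=(-\phi_2'T_{2,y},\ \phi_2'T_{2,x},\ \phi_2\operatorname{curl}_{2D}T_2)^T$, $$\|\operatorname{curl}T-\operatorname{curl}T_{2D/1D}\|_\rho^2+\|\sigma\gamma-\operatorname{curl}T\|_\rho^2=\|\sigma\gamma-\operatorname{curl}T_{2D/1D}\|_\rho^2,$$ and consequently $\|\operatorname{curl}T-\operatorname{curl}T_{2D/1D}\|_\rho^2\le\|\sigma\gamma-\operatorname{curl}T_{2D/1D}\|_\rho^2$. -/

import Mathlib

open MeasureTheory Set Filter Topology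

noncomputable section

namespace EddyCurrent

/-! ### Classical differential operators and test functions -/

/-- Partial derivative in the `i`-th coordinate direction. -/
def pd {n : ℕ} (i : Fin n) (f : (Fin n → ℝ) → ℂ) (x : Fin n → ℝ) : ℂ :=
  fderiv ℝ f x (Pi.single i 1)

/-- Classical three-dimensional curl. -/
def curl (F : (Fin 3 → ℝ) → Fin 3 → ℂ) (x : Fin 3 → ℝ) : Fin 3 → ℂ :=
  ![pd 1 (fun y => F y 2) x - pd 2 (fun y => F y 1) x,
    pd 2 (fun y => F y 0) x - pd 0 (fun y => F y 2) x,
    pd 0 (fun y => F y 1) x - pd 1 (fun y => F y 0) x]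

/-- Classical three-dimensional divergence. -/
def dvg (F : (Fin 3 → ℝ) → Fin 3 → ℂ) (x : Fin 3 → ℝ) : ℂ :=
  ∑ i, pd i (fun y => F y i) x

/-- `φ ∈ C_c^∞(U)`. -/
structure IsTest {n : ℕ} {E : Type} [NormedAddCommGroup E] [NormedSpace ℝ E]
    (U : Set (Fin n → ℝ)) (φ : (Fin n → ℝ) → E) : Prop where
  smooth : ContDiff ℝ ((⊤ : ℕ∞) : WithTop ℕ∞) φ
  compact : HasCompactSupport φ
  supp : tsupport φ ⊆ U

/-! ### Function spaces

Membership is stated for a field together with its weak derivative. The dot product of complex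
vectors is bilinear (no conjugation). -/

/-- `v ∈ L²(U)`. -/
def MemL2 {n : ℕ} {E : Type} [NormedAddCommGroup E]
    (U : Set (Fin n → ℝ)) (v : (Fin n → ℝ) → E) : Prop :=
  MemLp v 2 (volume.restrict U)

/-- `f ∈ H¹(U)` with weak gradient `g`. -/
structure MemH1 {n : ℕ} (U : Set (Fin n → ℝ)) (f : (Fin n → ℝ) → ℂ)
    (g : (Fin n → ℝ) → Fin n → ℂ) : Prop where
  memL2 : MemL2 U f
  grad_memL2 : MemL2 U g
  weak : ∀ φ : (Fin n → ℝ) → ℂ, IsTest U φ → ∀ i,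
    ∫ x in U, g x i * φ x = -∫ x in U, f x * pd i φ x

/-- `v ∈ H(curl, U)` with weak curl `c`, `U ⊆ ℝ³`. -/
structure MemHCurl (U : Set (Fin 3 → ℝ)) (v c : (Fin 3 → ℝ) → Fin 3 → ℂ) : Prop where
  memL2 : MemL2 U v
  curl_memL2 : MemL2 U c
  weak : ∀ φ : (Fin 3 → ℝ) → Fin 3 → ℂ, IsTest U φ →
    ∫ x in U, c x ⬝ᵥ φ x = ∫ x in U, v x ⬝ᵥ curl φ x

/-- `v ∈ H(curl_2D, U)` with weak scalar curl `c = ∂ₓ v_y - ∂_y vₓ`, `U ⊆ ℝ²`. -/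
structure MemHCurl2D (U : Set (Fin 2 → ℝ)) (v : (Fin 2 → ℝ) → Fin 2 → ℂ)
    (c : (Fin 2 → ℝ) → ℂ) : Prop where
  memL2 : MemL2 U v
  curl_memL2 : MemL2 U c
  weak : ∀ φ : (Fin 2 → ℝ) → ℂ, IsTest U φ →
    ∫ x in U, c x * φ x = ∫ x in U, (v x 0 * pd 1 φ x - v x 1 * pd 0 φ x)

/-- `f` vanishes almost everywhere in `U \ Uc`. -/
def VanishesOff {n : ℕ} {E : Type} [Zero E] (U Uc : Set (Fin n → ℝ))
    (f : (Fin n → ℝ) → E) : Prop :=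
  ∀ᵐ x ∂(volume.restrict (U \ Uc)), f x = 0

/-- Fields on the conductor `Uc`, identified with their extension by zero to `U`, the extension
being in `H(curl, U)` (its curl is then the extension by zero of the curl on `Uc`; the tangential
trace is continuous, hence zero, across the interface `U ∩ ∂Uc`, and is free on `∂U ∩ ∂Uc`). -/
structure MemHCurlCond (U Uc : Set (Fin 3 → ℝ)) (v c : (Fin 3 → ℝ) → Fin 3 → ℂ) : Prop where
  memHCurl : MemHCurl U v c
  vanish : VanishesOff U Uc v
  curl_vanish : VanishesOff U Uc c

/-- The two-dimensional analogue of `MemHCurlCond`. -/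
structure MemHCurl2DCond (U Uc : Set (Fin 2 → ℝ)) (v : (Fin 2 → ℝ) → Fin 2 → ℂ)
    (c : (Fin 2 → ℝ) → ℂ) : Prop where
  memHCurl : MemHCurl2D U v c
  vanish : VanishesOff U Uc v
  curl_vanish : VanishesOff U Uc c

/-- `F ∈ H₀(div, U)` with `div F = d`: the closure of `C_c^∞(U)` in the graph norm of the
divergence, i.e. the normal trace of `F` on `∂U` is zero. -/
def MemH0Div (U : Set (Fin 3 → ℝ)) (F : (Fin 3 → ℝ) → Fin 3 → ℂ) (d : (Fin 3 → ℝ) → ℂ) : Prop :=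
  MemL2 U F ∧ MemL2 U d ∧ ∃ ψ : ℕ → (Fin 3 → ℝ) → Fin 3 → ℂ, (∀ n, IsTest U (ψ n)) ∧
    Tendsto (fun n => eLpNorm (fun x => ψ n x - F x) 2 (volume.restrict U)) atTop (𝓝 0) ∧
    Tendsto (fun n => eLpNorm (fun x => dvg (ψ n) x - d x) 2 (volume.restrict U)) atTop (𝓝 0)

/-- The field `v` with curl `c` has zero tangential trace on the part `K` of the boundary of `U`:
it is a limit in `H(curl, U)` of smooth fields in `H(curl, U)` that vanish near `K`. -/
def ZeroTangentialTraceOn (U K : Set (Fin 3 → ℝ)) (v c : (Fin 3 → ℝ) → Fin 3 → ℂ) : Prop :=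
  ∃ g : ℕ → (Fin 3 → ℝ) → Fin 3 → ℂ,
    (∀ n, ContDiffOn ℝ ((⊤ : ℕ∞) : WithTop ℕ∞) (g n) U ∧ MemL2 U (g n) ∧ MemL2 U (curl (g n)) ∧
      ∃ W : Set (Fin 3 → ℝ), IsOpen W ∧ K ⊆ W ∧ ∀ x ∈ W ∩ U, g n x = 0) ∧
    Tendsto (fun n => eLpNorm (fun x => g n x - v x) 2 (volume.restrict U)) atTop (𝓝 0) ∧
    Tendsto (fun n => eLpNorm (fun x => curl (g n) x - c x) 2 (volume.restrict U)) atTop (𝓝 0)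

/-! ### Geometry and material -/

/-- A steel sheet with cross-section `Ω2Dc` and thickness `dFe`, centred at `z = 0`, in a domain
with cross-section `Ω2D`, with insulation of thickness `dBelow` and `dAbove` below and above it
(`d₀ = dBelow + dAbove`). -/
structure Geometry where
  Ω2D : Set (Fin 2 → ℝ)
  Ω2Dc : Set (Fin 2 → ℝ)
  isOpen_Ω2D : IsOpen Ω2D
  isOpen_Ω2Dc : IsOpen Ω2Dc
  isBounded_Ω2D : Bornology.IsBounded Ω2D
  subset : Ω2Dc ⊆ Ω2D
  dFe : ℝ
  dBelow : ℝ
  dAbove : ℝ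
  dFe_pos : 0 < dFe
  dBelow_nonneg : 0 ≤ dBelow
  dAbove_nonneg : 0 ≤ dAbove

/-- The projection `(x, y, z) ↦ (x, y)`. -/
def proj (x : Fin 3 → ℝ) : Fin 2 → ℝ := ![x 0, x 1]

/-- The problem domain. -/
def Geometry.Ω (G : Geometry) : Set (Fin 3 → ℝ) :=
  {x | proj x ∈ G.Ω2D ∧ x 2 ∈ Ioo (-(G.dFe / 2) - G.dBelow) (G.dFe / 2 + G.dAbove)}

/-- The conducting domain (the sheet). -/
def Geometry.Ωc (G : Geometry) : Set (Fin 3 → ℝ) :=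
  {x | proj x ∈ G.Ω2Dc ∧ x 2 ∈ Ioo (-(G.dFe / 2)) (G.dFe / 2)}

/-- Conductivity (on the conductor) and permeability; measurable, positive, bounded, and the
conductivity is bounded away from zero on the conductor, where the resistivity is `σ⁻¹`. -/
structure Material (G : Geometry) where
  σ : (Fin 3 → ℝ) → ℝ
  μ : (Fin 3 → ℝ) → ℝ
  measurable_σ : Measurable σ
  measurable_μ : Measurable μ
  σ_bounds : ∃ a b : ℝ, 0 < a ∧ ∀ x ∈ G.Ωc, a ≤ σ x ∧ σ x ≤ b
  μ_pos : ∀ x ∈ G.Ω, 0 < μ x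
  μ_bound : ∃ b : ℝ, ∀ x ∈ G.Ω, μ x ≤ b

/-- `‖J‖_ρ² = ∫ ρ J · J*`, `ρ = σ⁻¹`, over the conductor (currents vanish outside of it). -/
def Material.normSq {G : Geometry} (M : Material G) (J : (Fin 3 → ℝ) → Fin 3 → ℂ) : ℝ :=
  ∫ x in G.Ωc, (M.σ x)⁻¹ * ∑ i, ‖J x i‖ ^ 2

/-! ### The eddy current problem -/

/-- `(T, Φ)`, with `curl T = J` and `∇Φ = gΦ`, solves the eddy current problem
`curl ρ curl T + iωμ (T - ∇Φ + H_BS) = 0` with `div μ(T - ∇Φ + H_BS) = 0`, in weak form. -/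
structure IsEddyCurrentSolution {G : Geometry} (M : Material G) (ω : ℝ)
    (HBS T J : (Fin 3 → ℝ) → Fin 3 → ℂ) (Φ : (Fin 3 → ℝ) → ℂ)
    (gΦ : (Fin 3 → ℝ) → Fin 3 → ℂ) : Prop where
  memT : MemHCurlCond G.Ω G.Ωc T J
  memΦ : MemH1 G.Ω Φ gΦ
  weak : ∀ v cv q gq, MemHCurlCond G.Ω G.Ωc v cv → MemH1 G.Ω q gq →
    (∫ x in G.Ωc, ((M.σ x)⁻¹ : ℂ) * (J x ⬝ᵥ cv x))
      + (∫ x in G.Ω, Complex.I * ω * M.μ x * ((T x - gΦ x) ⬝ᵥ (v x - gq x)))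
      = -∫ x in G.Ω, Complex.I * ω * M.μ x * (HBS x ⬝ᵥ (v x - gq x))

/-! ### The 2D/1D MSFEM ansatz -/

/-- The shape function `φ₀`. -/
def phi0 (_z : ℝ) : ℝ := 1

/-- The shape function `φ₂`, quadratic in the sheet and extended by zero to the insulation. -/
def phi2 (dFe z : ℝ) : ℝ :=
  if |z| ≤ dFe / 2 then 1 / 2 * √(3 / 2) * ((2 * z / dFe) ^ 2 - 1) else 0

/-- The field `T_2D/1D = φ₀(z) T₀(x,y) + φ₂(z) T₂(x,y)` with `z`-component zero. -/
def msfemField (dFe : ℝ) (T0 T2 : (Fin 2 → ℝ) → Fin 2 → ℂ) (x : Fin 3 → ℝ) : Fin 3 → ℂ :=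
  ![phi0 (x 2) * T0 (proj x) 0 + phi2 dFe (x 2) * T2 (proj x) 0,
    phi0 (x 2) * T0 (proj x) 1 + phi2 dFe (x 2) * T2 (proj x) 1,
    0]

/-- The curl of `T_2D/1D`, where `c2 = curl_2D T₂`. -/
def msfemCurl (dFe : ℝ) (T2 : (Fin 2 → ℝ) → Fin 2 → ℂ) (c2 : (Fin 2 → ℝ) → ℂ)
    (x : Fin 3 → ℝ) : Fin 3 → ℂ :=
  ![-(deriv (phi2 dFe) (x 2) * T2 (proj x) 1),
    deriv (phi2 dFe) (x 2) * T2 (proj x) 0,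
    phi2 dFe (x 2) * c2 (proj x)]

/-- The required curl `-iωμ (T_2D/1D + H_BS)` of an equilibrated flux. -/
def fluxCurl {G : Geometry} (M : Material G) (ω : ℝ) (HBS Th : (Fin 3 → ℝ) → Fin 3 → ℂ)
    (x : Fin 3 → ℝ) : Fin 3 → ℂ :=
  (-(Complex.I * ω * M.μ x)) • (Th x + HBS x)

/-- `γ ∈ H(curl, Ω)` is an equilibrated flux: `curl γ = -iωμ (T_2D/1D + H_BS)` in `Ω`, with the
natural boundary conditions of the eddy current problem: `γ × n = 0` where the conductor meets
the outer boundary, and `curl γ · n = 0` on the outer boundary. -/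
structure IsEquilibratedFlux {G : Geometry} (M : Material G) (ω : ℝ)
    (HBS Th γ : (Fin 3 → ℝ) → Fin 3 → ℂ) : Prop where
  memHCurl : MemHCurl G.Ω γ (fluxCurl M ω HBS Th)
  tangential : ZeroTangentialTraceOn G.Ω (frontier G.Ω ∩ closure G.Ωc) γ (fluxCurl M ω HBS Th)
  normal : MemH0Div G.Ω (fluxCurl M ω HBS Th) (fun _ => 0)

end EddyCurrent

end

/-!
# A guaranteed upper bound for the error of the 2D/1D MSFEM

The proof is an argument of Prager–Synge type. Let `J = curl T`, let `J_h = curl T_2D/1D`, and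
write the ansatz as `T_2D/1D = ∇Φ₀ + φ₂ T₂`. By Pythagoras' theorem in the weighted space
(`Material.normSq_add`) it suffices that the two errors are orthogonal:
`Re ∫ ρ (σγ - J) · (J - J_h)* = 0`, the integral being taken over the sheet.

The gradient part of the ansatz is curl free, so `J - J_h` is the curl of `T - φ₂ T₂`. This field is
admissible in the weak formulation, since the profile `φ₂` is weakly differentiable across the
surfaces of the sheet (`memHCurlCond_phi2Field`). Test the eddy current problem with the conjugates
of `T - φ₂ T₂` and of `Φ + Φ₀`, and move the curl from `T - φ₂ T₂` to the flux `γ`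
(`ZeroTangentialTraceOn.integral_dotProduct_curl`); the gradient of `Φ + Φ₀` does not see `curl γ`,
whose normal trace and divergence vanish (`MemH0Div.integral_dotProduct_grad`). The source `H_BS`
cancels, and what remains is `iω ∫ μ |T - ∇Φ - T_2D/1D|²`, which is purely imaginary
(`integral_error_dotProduct`).

Green's formula for `γ` requires no trace theory. A smooth field that vanishes near the part of the
boundary touched by the sheet coincides near the closure of the sheet with a compactly supported
one, obtained by a cutoff (`exists_isTest_eventuallyEq`), and a potential supported in the sheet
cannot distinguish the two. The curl of the ansatz is computed by Fubini's theorem on the cylinder: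
horizontal slices of test functions are two-dimensional test functions, and vertical derivatives are
integrated by parts on an interval (`MemH1.comp_proj`, `MemHCurl2D.profile_mul`).
-/

namespace EddyCurrent

/-! ### Square-integrable fields -/

section L2

variable {α : Type*} [MeasurableSpace α] {ν : Measure α}

theorem norm_dotProduct_le {m : ℕ} (a b : Fin m → ℂ) : ‖a ⬝ᵥ b‖ ≤ m * ‖a‖ * ‖b‖ := by
  calc ‖a ⬝ᵥ b‖ ≤ ∑ i, ‖a i * b i‖ := norm_sum_le _ _
    _ ≤ ∑ _i : Fin m, ‖a‖ * ‖b‖ := by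
        gcongr with i
        rw [norm_mul]
        gcongr <;> exact norm_le_pi_norm _ i
    _ = m * ‖a‖ * ‖b‖ := by simp [mul_assoc]

theorem integrable_mul_of_memLp {f g : α → ℂ} (hf : MemLp f 2 ν) (hg : MemLp g 2 ν) :
    Integrable (fun x => f x * g x) ν :=
  hf.integrable_mul hg

theorem integrable_dotProduct {m : ℕ} {v w : α → Fin m → ℂ} (hv : MemLp v 2 ν)
    (hw : MemLp w 2 ν) : Integrable (fun x => v x ⬝ᵥ w x) ν :=
  integrable_finsetSum _ fun i _ => integrable_mul_of_memLp (hv.eval i) (hw.eval i)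

/-- Convergence in `L²` passes to the integrals of the pairings with a fixed `L²` field. -/
theorem tendsto_integral_dotProduct {m : ℕ} {v : ℕ → α → Fin m → ℂ} {u w : α → Fin m → ℂ}
    (hv : ∀ n, MemLp (v n) 2 ν) (hu : MemLp u 2 ν) (hw : MemLp w 2 ν)
    (h : Tendsto (fun n => eLpNorm (fun x => v n x - u x) 2 ν) atTop (𝓝 0)) :
    Tendsto (fun n => ∫ x, v n x ⬝ᵥ w x ∂ν) atTop (𝓝 (∫ x, u x ⬝ᵥ w x ∂ν)) := by
  refine tendsto_integral_of_L1' _ (integrable_dotProduct hu hw).aestronglyMeasurable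
    (Eventually.of_forall fun n => integrable_dotProduct (hv n) hw) ?_
  have hle : ∀ n, eLpNorm ((fun x => v n x ⬝ᵥ w x) - fun x => u x ⬝ᵥ w x) 1 ν
      ≤ ((m : NNReal) : ENNReal) * eLpNorm (fun x => v n x - u x) 2 ν * eLpNorm w 2 ν := by
    intro n
    have := eLpNorm_le_eLpNorm_mul_eLpNorm'_of_norm (p := 2) (q := 2) (r := 1)
      ((hv n).sub hu).aestronglyMeasurable hw.aestronglyMeasurable (fun a b => a ⬝ᵥ b) (m : NNReal)
      (Eventually.of_forall fun x => norm_dotProduct_le _ _)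
    refine le_of_eq_of_le (congrArg (eLpNorm · 1 ν) (funext fun x => ?_)) this
    exact (sub_dotProduct _ _ _).symm
  refine tendsto_of_tendsto_of_tendsto_of_le_of_le tendsto_const_nhds ?_ (fun _ => zero_le) hle
  have h1 := ENNReal.Tendsto.const_mul (a := ((m : NNReal) : ENNReal)) h (Or.inr ENNReal.coe_ne_top)
  have h2 := ENNReal.Tendsto.mul_const (b := eLpNorm w 2 ν) h1 (Or.inr hw.2.ne)
  simpa using h2

theorem tendsto_integral_mul {v : ℕ → α → ℂ} {u w : α → ℂ}
    (hv : ∀ n, MemLp (v n) 2 ν) (hu : MemLp u 2 ν) (hw : MemLp w 2 ν)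
    (h : Tendsto (fun n => eLpNorm (fun x => v n x - u x) 2 ν) atTop (𝓝 0)) :
    Tendsto (fun n => ∫ x, v n x * w x ∂ν) atTop (𝓝 (∫ x, u x * w x ∂ν)) := by
  have e : ∀ f : α → ℂ, MemLp f 2 ν → MemLp (fun x (_ : Fin 1) => f x) 2 ν :=
    fun f hf => memLp_pi_iff.2 fun _ => hf
  have := tendsto_integral_dotProduct (fun n => e _ (hv n)) (e _ hu) (e _ hw) (by
    refine h.congr fun n => eLpNorm_congr_norm_ae (Eventually.of_forall fun x => ?_)
    simp [Pi.norm_def])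
  simpa [dotProduct] using this

/-- Multiplication by a bounded measurable function preserves square integrability. -/
theorem memLp_ofReal_smul {m : ℕ} {a : α → ℝ} {v : α → Fin m → ℂ} (ha : AEStronglyMeasurable a ν)
    {C : ℝ} (hC : ∀ᵐ x ∂ν, |a x| ≤ C) (hv : MemLp v 2 ν) :
    MemLp (fun x => (a x : ℂ) • v x) 2 ν := by
  refine hv.of_le_mul (c := C)
    ((Complex.continuous_ofReal.comp_aestronglyMeasurable ha).smul hv.1) ?_
  filter_upwards [hC] with x hx
  rw [norm_smul, Complex.norm_real, Real.norm_eq_abs]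
  gcongr

theorem memLp_star {m : ℕ} {v : α → Fin m → ℂ} (hv : MemLp v 2 ν) :
    MemLp (fun x => star (v x)) 2 ν :=
  hv.of_le (continuous_star.comp_aestronglyMeasurable hv.1)
    (Eventually.of_forall fun x => (norm_star (v x)).le)

theorem memLp_star_complex {v : α → ℂ} (hv : MemLp v 2 ν) :
    MemLp (fun x => star (v x)) 2 ν :=
  hv.of_le (continuous_star.comp_aestronglyMeasurable hv.1)
    (Eventually.of_forall fun x => (norm_star (v x)).le)

end L2

/-! ### Smooth fields -/

section Smooth

variable {n : ℕ}

theorem contDiff_pd {f : (Fin n → ℝ) → ℂ} (hf : ContDiff ℝ ((⊤ : ℕ∞) : WithTop ℕ∞) f) (i : Fin n) :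
    ContDiff ℝ ((⊤ : ℕ∞) : WithTop ℕ∞) (pd i f) :=
  (hf.fderiv_right (m := ((⊤ : ℕ∞) : WithTop ℕ∞)) (by simp)).clm_apply contDiff_const

theorem pd_eq_zero_of_notMem_tsupport {f : (Fin n → ℝ) → ℂ} {x : Fin n → ℝ} (i : Fin n)
    (hx : x ∉ tsupport f) : pd i f x = 0 := by
  have h : f =ᶠ[𝓝 x] fun _ => 0 := notMem_tsupport_iff_eventuallyEq.1 hx
  simp [pd, h.fderiv_eq]

theorem tsupport_pd_subset (f : (Fin n → ℝ) → ℂ) (i : Fin n) : tsupport (pd i f) ⊆ tsupport f :=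
  closure_minimal (fun _ hx => by_contra fun h => hx (pd_eq_zero_of_notMem_tsupport i h))
    (isClosed_tsupport f)

theorem IsTest.pd {U : Set (Fin n → ℝ)} {f : (Fin n → ℝ) → ℂ} (hf : IsTest U f) (i : Fin n) :
    IsTest U (pd i f) where
  smooth := contDiff_pd hf.smooth i
  compact := hf.compact.mono' (subset_tsupport _ |>.trans (tsupport_pd_subset f i))
  supp := (tsupport_pd_subset f i).trans hf.supp

theorem IsTest.eval {m : ℕ} {U : Set (Fin n → ℝ)} {f : (Fin n → ℝ) → Fin m → ℂ}
    (hf : IsTest U f) (i : Fin m) : IsTest U (fun x => f x i) where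
  smooth := contDiff_pi.1 hf.smooth i
  compact := hf.compact.comp_left (g := fun a : Fin m → ℂ => a i) rfl
  supp := (closure_mono (Function.support_subset_iff'.2 fun x hx => by
    simp [Function.notMem_support.1 hx])).trans hf.supp

theorem IsTest.memLp {E : Type} [NormedAddCommGroup E] [NormedSpace ℝ E] {U : Set (Fin n → ℝ)}
    {f : (Fin n → ℝ) → E} (hf : IsTest U f) (V : Set (Fin n → ℝ)) : MemL2 V f :=
  (hf.smooth.continuous.memLp_of_hasCompactSupport hf.compact).restrict V

theorem IsTest.memL2_curl {U : Set (Fin 3 → ℝ)} {f : (Fin 3 → ℝ) → Fin 3 → ℂ} (hf : IsTest U f)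
    (V : Set (Fin 3 → ℝ)) : MemL2 V (curl f) := by
  have h := fun i j => ((hf.eval i).pd j).memLp V
  refine memLp_pi_iff.2 fun i => ?_
  fin_cases i
  · exact (h 2 1).sub (h 1 2)
  · exact (h 0 2).sub (h 2 0)
  · exact (h 1 0).sub (h 0 1)

theorem IsTest.memL2_dvg {U : Set (Fin 3 → ℝ)} {f : (Fin 3 → ℝ) → Fin 3 → ℂ} (hf : IsTest U f)
    (V : Set (Fin 3 → ℝ)) : MemL2 V (dvg f) :=
  memLp_finsetSum _ fun i _ => ((hf.eval i).pd i).memLp V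

theorem IsTest.star {E : Type} [NormedAddCommGroup E] [NormedSpace ℝ E] [StarAddMonoid E]
    [NormedStarGroup E] [StarModule ℝ E] {U : Set (Fin n → ℝ)} {f : (Fin n → ℝ) → E}
    (hf : IsTest U f) : IsTest U (fun x => star (f x)) where
  smooth := (starL' ℝ (A := E)).contDiff.comp hf.smooth
  compact := hf.compact.comp_left (g := fun a : E => Star.star a) (star_zero _)
  supp := (closure_mono (Function.support_subset_iff'.2 fun x hx => by
    simp [Function.notMem_support.1 hx])).trans hf.supp

theorem pd_star (i : Fin n) (f : (Fin n → ℝ) → ℂ) (x : Fin n → ℝ) :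
    pd i (fun y => star (f y)) x = star (pd i f x) := by
  have := (starL' ℝ (A := ℂ)).comp_fderiv (f := f) (x := x)
  simp only [pd]
  erw [this]
  rfl

theorem curl_star (F : (Fin 3 → ℝ) → Fin 3 → ℂ) (x : Fin 3 → ℝ) :
    curl (fun y => star (F y)) x = star (curl F x) := by
  ext i
  have h := fun i j => pd_star i (fun y => F y j) x
  fin_cases i <;> simp [curl] <;> exact congrArg₂ _ (h _ _) (h _ _)

/-- Mixed second derivatives of a smooth function commute. -/
theorem pd_comm {f : (Fin n → ℝ) → ℂ} (hf : ContDiff ℝ ((⊤ : ℕ∞) : WithTop ℕ∞) f) (i j : Fin n)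
    (x : Fin n → ℝ) : pd i (pd j f) x = pd j (pd i f) x := by
  have hs := hf.contDiffAt.isSymmSndFDerivAt (x := x)
    (by simpa using WithTop.coe_le_coe.2 (le_top (a := (2 : ℕ∞))))
  have hd : DifferentiableAt ℝ (fderiv ℝ f) x :=
    ((hf.fderiv_right (m := ((⊤ : ℕ∞) : WithTop ℕ∞)) (by simp)).differentiable (by simp)) x
  have key : ∀ i j : Fin n, pd i (pd j f) x
      = fderiv ℝ (fderiv ℝ f) x (Pi.single i 1) (Pi.single j 1) := by
    intro i j
    have : pd j f = fun y => fderiv ℝ f y (Pi.single j 1) := rfl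
    rw [this, pd, fderiv_clm_apply hd (differentiableAt_const _)]
    simp
  rw [key, key, hs]

end Smooth

/-! ### Sobolev spaces -/

theorem MemH1.add {n : ℕ} {U : Set (Fin n → ℝ)} {f f' : (Fin n → ℝ) → ℂ}
    {g g' : (Fin n → ℝ) → Fin n → ℂ} (h : MemH1 U f g) (h' : MemH1 U f' g') :
    MemH1 U (fun x => f x + f' x) (fun x => g x + g' x) where
  memL2 := h.memL2.add h'.memL2
  grad_memL2 := h.grad_memL2.add h'.grad_memL2
  weak φ hφ i := by
    have hp := hφ.memLp U
    have hq := (hφ.pd i).memLp U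
    simp only [Pi.add_apply, add_mul]
    rw [integral_add (integrable_mul_of_memLp (h.grad_memL2.eval i) hp)
        (integrable_mul_of_memLp (h'.grad_memL2.eval i) hp),
      integral_add (integrable_mul_of_memLp h.memL2 hq) (integrable_mul_of_memLp h'.memL2 hq),
      h.weak φ hφ i, h'.weak φ hφ i]
    ring

theorem MemH1.star {n : ℕ} {U : Set (Fin n → ℝ)} {f : (Fin n → ℝ) → ℂ}
    {g : (Fin n → ℝ) → Fin n → ℂ} (h : MemH1 U f g) :
    MemH1 U (fun x => star (f x)) (fun x => star (g x)) where
  memL2 := memLp_star_complex h.memL2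
  grad_memL2 := memLp_star h.grad_memL2
  weak φ hφ i := by
    have := congrArg (starRingEnd ℂ) (h.weak _ hφ.star i)
    simp only [pd_star] at this
    rw [map_neg, ← integral_conj, ← integral_conj] at this
    simpa using this

theorem MemHCurl.add {U : Set (Fin 3 → ℝ)} {v c v' c' : (Fin 3 → ℝ) → Fin 3 → ℂ}
    (h : MemHCurl U v c) (h' : MemHCurl U v' c') :
    MemHCurl U (fun x => v x + v' x) (fun x => c x + c' x) where
  memL2 := h.memL2.add h'.memL2
  curl_memL2 := h.curl_memL2.add h'.curl_memL2
  weak φ hφ := by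
    simp only [add_dotProduct]
    rw [integral_add (integrable_dotProduct h.curl_memL2 (hφ.memLp U))
        (integrable_dotProduct h'.curl_memL2 (hφ.memLp U)),
      integral_add (integrable_dotProduct h.memL2 (hφ.memL2_curl U))
        (integrable_dotProduct h'.memL2 (hφ.memL2_curl U)), h.weak φ hφ, h'.weak φ hφ]

theorem MemHCurl.neg {U : Set (Fin 3 → ℝ)} {v c : (Fin 3 → ℝ) → Fin 3 → ℂ}
    (h : MemHCurl U v c) : MemHCurl U (fun x => -v x) (fun x => -c x) where
  memL2 := h.memL2.neg
  curl_memL2 := h.curl_memL2.neg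
  weak φ hφ := by simp only [neg_dotProduct, integral_neg, h.weak φ hφ]

theorem MemHCurl.star {U : Set (Fin 3 → ℝ)} {v c : (Fin 3 → ℝ) → Fin 3 → ℂ}
    (h : MemHCurl U v c) : MemHCurl U (fun x => star (v x)) (fun x => star (c x)) where
  memL2 := memLp_star h.memL2
  curl_memL2 := memLp_star h.curl_memL2
  weak φ hφ := by
    have := congrArg (starRingEnd ℂ) (h.weak _ hφ.star)
    rw [← integral_conj, ← integral_conj] at this
    simpa [curl_star, dotProduct] using this

theorem MemHCurlCond.star {U Uc : Set (Fin 3 → ℝ)} {v c : (Fin 3 → ℝ) → Fin 3 → ℂ}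
    (h : MemHCurlCond U Uc v c) :
    MemHCurlCond U Uc (fun x => star (v x)) (fun x => star (c x)) where
  memHCurl := h.memHCurl.star
  vanish := h.vanish.mono fun x hx => by simp [hx]
  curl_vanish := h.curl_vanish.mono fun x hx => by simp [hx]

theorem MemHCurlCond.sub {U Uc : Set (Fin 3 → ℝ)} {v c v' c' : (Fin 3 → ℝ) → Fin 3 → ℂ}
    (h : MemHCurlCond U Uc v c) (h' : MemHCurlCond U Uc v' c') :
    MemHCurlCond U Uc (fun x => v x - v' x) (fun x => c x - c' x) where
  memHCurl := by simpa only [sub_eq_add_neg] using h.memHCurl.add h'.memHCurl.neg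
  vanish := by
    filter_upwards [h.vanish, h'.vanish] with x hx hx'
    simp [hx, hx']
  curl_vanish := by
    filter_upwards [h.curl_vanish, h'.curl_vanish] with x hx hx'
    simp [hx, hx']

theorem IsTest.dvg_curl {U : Set (Fin 3 → ℝ)} {φ : (Fin 3 → ℝ) → Fin 3 → ℂ} (hφ : IsTest U φ)
    (x : Fin 3 → ℝ) : dvg (curl φ) x = 0 := by
  have hs := fun i => (hφ.eval i).smooth
  have hd : ∀ i j, DifferentiableAt ℝ (EddyCurrent.pd j fun y => φ y i) x := fun i j =>
    ((contDiff_pd (hs i) j).differentiable (by simp)) x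
  have hsub : ∀ (i : Fin 3) (f g : (Fin 3 → ℝ) → ℂ), DifferentiableAt ℝ f x →
      DifferentiableAt ℝ g x → EddyCurrent.pd i (fun y => f y - g y) x
        = EddyCurrent.pd i f x - EddyCurrent.pd i g x := by
    intro i f g hf hg
    simp only [EddyCurrent.pd]
    rw [fderiv_fun_sub hf hg]
    rfl
  have hc := fun i j k => pd_comm (hs i) j k x
  simp only [dvg, curl, Fin.sum_univ_three, Matrix.cons_val_zero, Matrix.cons_val_one,
    Matrix.cons_val]
  rw [hsub _ _ _ (hd _ _) (hd _ _), hsub _ _ _ (hd _ _) (hd _ _), hsub _ _ _ (hd _ _) (hd _ _),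
    hc 2 0 1, hc 1 0 2, hc 0 1 2]
  ring

/-- Testing a weak gradient with a vector field gives minus the integral against the divergence. -/
theorem MemH1.integral_dotProduct {U : Set (Fin 3 → ℝ)} {q : (Fin 3 → ℝ) → ℂ}
    {g ψ : (Fin 3 → ℝ) → Fin 3 → ℂ} (h : MemH1 U q g) (hψ : ∀ i, IsTest U fun x => ψ x i) :
    ∫ x in U, g x ⬝ᵥ ψ x = -∫ x in U, q x * dvg ψ x := by
  simp only [dotProduct, dvg, Finset.mul_sum]
  rw [integral_finsetSum _ fun i _ => integrable_mul_of_memLp (h.grad_memL2.eval i)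
      ((hψ i).memLp U), integral_finsetSum _ fun i _ => integrable_mul_of_memLp h.memL2
      (((hψ i).pd i).memLp U), ← Finset.sum_neg_distrib]
  exact Finset.sum_congr rfl fun i _ => h.weak _ (hψ i) i

/-- Weak gradients are curl free. -/
theorem MemH1.memHCurl_grad {U : Set (Fin 3 → ℝ)} {q : (Fin 3 → ℝ) → ℂ}
    {g : (Fin 3 → ℝ) → Fin 3 → ℂ} (h : MemH1 U q g) : MemHCurl U g (fun _ => 0) where
  memL2 := h.grad_memL2
  curl_memL2 := MemLp.zero'
  weak φ hφ := by
    have hsub : ∀ {f g : (Fin 3 → ℝ) → ℂ}, IsTest U f → IsTest U g →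
        IsTest U fun x => f x - g x := fun {f g} hf hg => by
      refine ⟨hf.smooth.sub hg.smooth, hf.compact.sub hg.compact, ?_⟩
      exact (tsupport_sub f g).trans (union_subset hf.supp hg.supp)
    have ht := fun i j => (hφ.eval i).pd j
    rw [h.integral_dotProduct (ψ := curl φ)]
    · simp [hφ.dvg_curl]
    · intro i
      fin_cases i
      · exact hsub (ht 2 1) (ht 1 2)
      · exact hsub (ht 0 2) (ht 2 0)
      · exact hsub (ht 1 0) (ht 0 1)

/-- A field with zero normal trace and zero divergence is orthogonal to all gradients. -/
theorem MemH0Div.integral_dotProduct_grad {U : Set (Fin 3 → ℝ)} {F : (Fin 3 → ℝ) → Fin 3 → ℂ}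
    (hF : MemH0Div U F fun _ => 0) {q : (Fin 3 → ℝ) → ℂ} {g : (Fin 3 → ℝ) → Fin 3 → ℂ}
    (h : MemH1 U q g) : ∫ x in U, F x ⬝ᵥ g x = 0 := by
  obtain ⟨hF2, h02, ψ, hψ, hlim, hdiv⟩ := hF
  have h1 := tendsto_integral_dotProduct (fun n => (hψ n).memLp U) hF2 h.grad_memL2 hlim
  have h2 := (tendsto_integral_mul (fun n => (hψ n).memL2_dvg U) h02 h.memL2 hdiv).neg
  refine tendsto_nhds_unique h1 ?_
  simp only [zero_mul, integral_zero, neg_zero] at h2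
  refine h2.congr fun n => ?_
  simp only [mul_comm (dvg _ _)]
  rw [← h.integral_dotProduct fun i => (hψ n).eval i]
  simp only [dotProduct_comm]

/-! ### Integration by parts for the curl -/

theorem pd_congr_of_eventuallyEq {n : ℕ} {f g : (Fin n → ℝ) → ℂ} {x : Fin n → ℝ} (h : f =ᶠ[𝓝 x] g)
    (i : Fin n) : pd i f x = pd i g x := by
  simp [pd, h.fderiv_eq]

theorem curl_congr_of_eventuallyEq {F H : (Fin 3 → ℝ) → Fin 3 → ℂ} {x : Fin 3 → ℝ}
    (h : F =ᶠ[𝓝 x] H) : curl F x = curl H x := by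
  have hi : ∀ i j, pd i (fun y => F y j) x = pd i (fun y => H y j) x := fun i j =>
    pd_congr_of_eventuallyEq (h.mono fun y hy => by rw [hy]) i
  simp [curl, hi]

/-- A smooth field on `U` that vanishes near `frontier U ∩ closure Uc` agrees near every point of
`U ∩ closure Uc` with a test field on `U`. -/
theorem exists_isTest_eventuallyEq {n : ℕ} {E : Type} [NormedAddCommGroup E] [NormedSpace ℝ E]
    {U Uc W : Set (Fin n → ℝ)} (hU : IsOpen U)
    (hb : Bornology.IsBounded U) (hsub : Uc ⊆ U) (hW : IsOpen W)
    (hKW : frontier U ∩ closure Uc ⊆ W) {g : (Fin n → ℝ) → E}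
    (hg : ContDiffOn ℝ ((⊤ : ℕ∞) : WithTop ℕ∞) g U) (h0 : ∀ x ∈ W ∩ U, g x = 0) :
    ∃ φ, IsTest U φ ∧ ∀ x ∈ U ∩ closure Uc, φ =ᶠ[𝓝 x] g := by
  have hC : IsCompact (closure Uc \ W) := (hb.subset hsub).isCompact_closure.diff hW
  have hCU : closure Uc \ W ⊆ U := by
    rintro x ⟨hx, hxW⟩
    by_contra hxU
    exact hxW (hKW ⟨⟨closure_mono hsub hx, by rwa [hU.interior_eq]⟩, hx⟩)
  obtain ⟨L, hL, hCL, hLU⟩ := exists_compact_between hC hU hCU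
  obtain ⟨χ, hχ1, hχ0, -⟩ := exists_contMDiffMap_one_nhds_of_subset_interior
    (modelWithCornersSelf ℝ (Fin n → ℝ)) hC.isClosed hCL (n := (⊤ : ℕ∞))
  have hχ : ContDiff ℝ ((⊤ : ℕ∞) : WithTop ℕ∞) χ := χ.contMDiff.contDiff
  have hts : tsupport (fun x => χ x • g x) ⊆ L := by
    refine closure_minimal (fun x hx => ?_) hL.isClosed
    by_contra hxL
    exact hx (by simp [hχ0 x hxL])
  refine ⟨fun x => χ x • g x, ⟨?_, ?_, hts.trans hLU⟩, ?_⟩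
  · refine contDiff_iff_contDiffAt.2 fun x => ?_
    by_cases hx : x ∈ U
    · exact hχ.contDiffAt.smul (hg.contDiffAt (hU.mem_nhds hx))
    · have := notMem_tsupport_iff_eventuallyEq.1 fun h => hx (hLU (hts h))
      exact contDiffAt_const.congr_of_eventuallyEq this
  · exact hL.of_isClosed_subset (isClosed_tsupport _) hts
  · rintro x ⟨hxU, hxc⟩
    by_cases hxW : x ∈ W
    · filter_upwards [(hW.inter hU).mem_nhds ⟨hxW, hxU⟩] with y hy
      simp [h0 y hy]
    · have hxC : x ∈ closure Uc \ W := ⟨hxc, hxW⟩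
      filter_upwards [hχ1.filter_mono (nhds_le_nhdsSet hxC)] with y hy
      simp [hy]

/-- Green's formula without boundary term: the tangential trace of `γ` vanishes on the part of the
boundary that is touched by the support of `v`. -/
theorem ZeroTangentialTraceOn.integral_dotProduct_curl {U Uc : Set (Fin 3 → ℝ)} (hU : IsOpen U)
    (hb : Bornology.IsBounded U) (hsub : Uc ⊆ U) {γ cγ v cv : (Fin 3 → ℝ) → Fin 3 → ℂ}
    (hγ : MemHCurl U γ cγ) (ht : ZeroTangentialTraceOn U (frontier U ∩ closure Uc) γ cγ)
    (hv : MemHCurlCond U Uc v cv) :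
    ∫ x in U, γ x ⬝ᵥ cv x = ∫ x in U, cγ x ⬝ᵥ v x := by
  obtain ⟨g, hg, hlim, hclim⟩ := ht
  have h1 := tendsto_integral_dotProduct (fun n => (hg n).2.1) hγ.memL2 hv.memHCurl.curl_memL2 hlim
  have h2 := tendsto_integral_dotProduct (fun n => (hg n).2.2.1) hγ.curl_memL2 hv.memHCurl.memL2
    hclim
  refine tendsto_nhds_unique h1 (h2.congr fun n => ?_)
  obtain ⟨hs, -, -, W, hW, hKW, h0⟩ := hg n
  obtain ⟨φ, hφ, hφg⟩ := exists_isTest_eventuallyEq hU hb hsub hW hKW hs h0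
  -- a field supported in `Uc` does not see the difference between `g n` and the test field `φ`
  have key : ∀ {w a b : (Fin 3 → ℝ) → Fin 3 → ℂ}, VanishesOff U Uc w →
      (∀ x ∈ U ∩ closure Uc, a x = b x) →
      ∫ x in U, w x ⬝ᵥ a x = ∫ x in U, w x ⬝ᵥ b x := by
    intro w a b hw hab
    refine integral_congr_ae ?_
    have hw' : ∀ᵐ x ∂volume.restrict (U \ closure Uc), w x = 0 :=
      ae_restrict_of_ae_restrict_of_subset (sdiff_subset_sdiff_right subset_closure) hw
    have hm : MeasurableSet (U \ closure Uc) := hU.measurableSet.diff isClosed_closure.measurableSet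
    filter_upwards [ae_restrict_mem hU.measurableSet,
      ae_restrict_of_ae ((ae_restrict_iff' hm).1 hw')] with x hx hx0
    by_cases hxc : x ∈ closure Uc
    · rw [hab x ⟨hx, hxc⟩]
    · simp [hx0 ⟨hx, hxc⟩]
  have e1 := key hv.curl_vanish fun x hx => (hφg x hx).eq_of_nhds
  have e2 := key hv.vanish fun x hx => curl_congr_of_eventuallyEq (hφg x hx)
  have e3 := hv.memHCurl.weak φ hφ
  simp only [dotProduct_comm (g n _), dotProduct_comm (curl (g n) _)]
  rw [← e1, ← e2, e3]

/-! ### Cylinders and Fubini's theorem -/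

/-- The splitting `(x, y, z) ↦ (z, (x, y))` of space into the vertical and horizontal variables. -/
def split (x : Fin 3 → ℝ) : ℝ × (Fin 2 → ℝ) := (x 2, proj x)

/-- The point of space with vertical coordinate `z` and horizontal coordinates `y`. -/
def ins (z : ℝ) (y : Fin 2 → ℝ) : Fin 3 → ℝ := ![y 0, y 1, z]

/-- The horizontal field on space defined by a planar field, constant in the vertical direction. -/
def liftField (v : (Fin 2 → ℝ) → Fin 2 → ℂ) (x : Fin 3 → ℝ) : Fin 3 → ℂ :=
  ![v (proj x) 0, v (proj x) 1, 0]

/-- The cylinder with cross-section `S` and vertical extent `I`. -/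
def cyl (S : Set (Fin 2 → ℝ)) (I : Set ℝ) : Set (Fin 3 → ℝ) := split ⁻¹' (I ×ˢ S)

@[simp] theorem proj_ins (z : ℝ) (y : Fin 2 → ℝ) : proj (ins z y) = y := by
  ext i
  fin_cases i <;> rfl

@[simp] theorem ins_two (z : ℝ) (y : Fin 2 → ℝ) : ins z y 2 = z := rfl

theorem ins_split (x : Fin 3 → ℝ) : ins (split x).1 (split x).2 = x := by
  ext i
  fin_cases i <;> rfl

theorem continuous_proj : Continuous proj := continuous_pi fun i => by
  fin_cases i
  · exact continuous_apply 0
  · exact continuous_apply 1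

theorem split_eq : split = MeasurableEquiv.piFinSuccAbove (fun _ : Fin 3 => ℝ) 2 := by
  ext x i
  · rfl
  · fin_cases i <;> rfl

theorem measurePreserving_split : MeasurePreserving split := by
  rw [split_eq]
  exact volume_preserving_piFinSuccAbove (fun _ => ℝ) 2

theorem measurableEmbedding_split : MeasurableEmbedding split := by
  rw [split_eq]
  exact MeasurableEquiv.measurableEmbedding _

theorem mem_cyl {S : Set (Fin 2 → ℝ)} {I : Set ℝ} {x : Fin 3 → ℝ} :
    x ∈ cyl S I ↔ x 2 ∈ I ∧ proj x ∈ S := Iff.rfl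

theorem measurePreserving_split_restrict (S : Set (Fin 2 → ℝ)) (I : Set ℝ) :
    MeasurePreserving split (volume.restrict (cyl S I))
      ((volume.restrict I).prod (volume.restrict S)) := by
  rw [Measure.prod_restrict]
  exact measurePreserving_split.restrict_preimage_emb measurableEmbedding_split _

/-- Almost every property of the horizontal variables holds almost everywhere in space. -/
theorem ae_proj {p : (Fin 2 → ℝ) → Prop} (h : ∀ᵐ y, p y) : ∀ᵐ x : Fin 3 → ℝ, p (proj x) :=
  measurePreserving_split.quasiMeasurePreserving.ae
    ((Measure.quasiMeasurePreserving_snd (μ := (volume : Measure ℝ))).ae h)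

section Fubini

variable {S : Set (Fin 2 → ℝ)} {I : Set ℝ}

theorem integrable_ins {F : (Fin 3 → ℝ) → ℂ} (hF : IntegrableOn F (cyl S I)) :
    Integrable (fun p : ℝ × (Fin 2 → ℝ) => F (ins p.1 p.2))
      ((volume.restrict I).prod (volume.restrict S)) := by
  rw [← (measurePreserving_split_restrict S I).integrable_comp_emb measurableEmbedding_split]
  simpa only [Function.comp_def, ins_split] using! hF

theorem setIntegral_cyl {F : (Fin 3 → ℝ) → ℂ} (hF : IntegrableOn F (cyl S I)) :
    ∫ x in cyl S I, F x = ∫ z in I, ∫ y in S, F (ins z y) := by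
  rw [← integral_prod _ (integrable_ins hF),
    ← (measurePreserving_split_restrict S I).integral_comp measurableEmbedding_split]
  simp only [ins_split]

theorem setIntegral_cyl_symm {F : (Fin 3 → ℝ) → ℂ} (hF : IntegrableOn F (cyl S I)) :
    ∫ x in cyl S I, F x = ∫ y in S, ∫ z in I, F (ins z y) := by
  rw [← integral_prod_symm _ (integrable_ins hF),
    ← (measurePreserving_split_restrict S I).integral_comp measurableEmbedding_split]
  simp only [ins_split]

theorem memL2_comp_proj [IsFiniteMeasure (volume.restrict I)] {E : Type} [NormedAddCommGroup E]
    {f : (Fin 2 → ℝ) → E} (hf : MemL2 S f) : MemL2 (cyl S I) fun x => f (proj x) :=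
  (hf.comp_snd (volume.restrict I)).comp_measurePreserving (measurePreserving_split_restrict S I)

/-- Separated products of a bounded profile and a square-integrable function. -/
theorem memL2_mul_comp_proj [IsFiniteMeasure (volume.restrict I)] {η : ℝ → ℝ}
    (hη : Measurable η) {C : ℝ} (hC : ∀ z, |η z| ≤ C) {f : (Fin 2 → ℝ) → ℂ} (hf : MemL2 S f) :
    MemL2 (cyl S I) fun x => (η (x 2) : ℂ) * f (proj x) := by
  refine (memL2_comp_proj hf).of_le_mul (c := C) ?_ (Eventually.of_forall fun x => ?_)
  · exact (Complex.continuous_ofReal.measurable.comp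
      (hη.comp (measurable_pi_apply 2))).aestronglyMeasurable.mul (memL2_comp_proj hf).1
  · rw [norm_mul, Complex.norm_real, Real.norm_eq_abs]
    gcongr
    exact hC _

/-! ### Weak derivatives of separated products -/

theorem hasFDerivAt_ins (z : ℝ) (y : Fin 2 → ℝ) :
    HasFDerivAt (ins z) (ContinuousLinearMap.pi
      ![ContinuousLinearMap.proj 0, ContinuousLinearMap.proj 1, 0] :
        (Fin 2 → ℝ) →L[ℝ] (Fin 3 → ℝ)) y := by
  refine hasFDerivAt_pi.2 fun i => ?_
  fin_cases i
  · exact hasFDerivAt_apply 0 y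
  · exact hasFDerivAt_apply 1 y
  · exact hasFDerivAt_const z y

theorem contDiff_ins (z : ℝ) : ContDiff ℝ ((⊤ : ℕ∞) : WithTop ℕ∞) (ins z) := by
  refine contDiff_pi.2 fun i => ?_
  fin_cases i
  · exact contDiff_apply ℝ ℝ 0
  · exact contDiff_apply ℝ ℝ 1
  · exact contDiff_const

theorem hasDerivAt_ins (z : ℝ) (y : Fin 2 → ℝ) :
    HasDerivAt (fun z => ins z y) (Pi.single 2 1) z := by
  refine hasDerivAt_pi.2 fun i => ?_
  fin_cases i
  · exact hasDerivAt_const z _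
  · exact hasDerivAt_const z _
  · exact hasDerivAt_id z

theorem IsTest.differentiable {n : ℕ} {U : Set (Fin n → ℝ)} {φ : (Fin n → ℝ) → ℂ}
    (hφ : IsTest U φ) : Differentiable ℝ φ := hφ.smooth.differentiable (by simp)

variable {φ : (Fin 3 → ℝ) → ℂ}

theorem IsTest.hasDerivAt_ins (hφ : IsTest (cyl S I) φ) (z : ℝ) (y : Fin 2 → ℝ) :
    HasDerivAt (fun z => φ (ins z y)) (EddyCurrent.pd 2 φ (ins z y)) z :=
  (hφ.differentiable (ins z y)).hasFDerivAt.comp_hasDerivAt z (EddyCurrent.hasDerivAt_ins z y)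

theorem IsTest.pd_ins (hφ : IsTest (cyl S I) φ) (z : ℝ) (y : Fin 2 → ℝ) (i : Fin 2) :
    EddyCurrent.pd i (fun y => φ (ins z y)) y = EddyCurrent.pd i.castSucc φ (ins z y) := by
  have h := (hφ.differentiable (ins z y)).hasFDerivAt.comp y (hasFDerivAt_ins z y)
  rw [EddyCurrent.pd, EddyCurrent.pd]
  erw [h.fderiv]
  rw [ContinuousLinearMap.comp_apply]
  congr 1
  ext j
  fin_cases i <;> fin_cases j <;> simp

/-- Horizontal slices of test functions are test functions. -/
theorem IsTest.comp_ins (hφ : IsTest (cyl S I) φ) (z : ℝ) : IsTest S fun y => φ (ins z y) := by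
  have hsub : tsupport (fun y => φ (ins z y)) ⊆ ins z ⁻¹' tsupport φ :=
    closure_minimal (fun y hy => subset_tsupport φ hy)
      ((isClosed_tsupport φ).preimage (contDiff_ins z).continuous)
  refine ⟨hφ.smooth.comp (contDiff_ins z), ?_, fun y hy => ?_⟩
  · refine (hφ.compact.isCompact.image continuous_proj).of_isClosed_subset (isClosed_tsupport _)
      fun y hy => ?_
    exact ⟨ins z y, hsub hy, proj_ins z y⟩
  · have := (mem_cyl.1 (hφ.supp (hsub hy))).2
    rwa [proj_ins] at this

/-- The profile `η` has the derivative `η'` on `I` in the sense of integration by parts against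
functions vanishing outside of `I`. -/
def HasProfileDeriv (I : Set ℝ) (η η' : ℝ → ℝ) : Prop :=
  ∀ ψ ψ' : ℝ → ℂ, (∀ z, HasDerivAt ψ (ψ' z) z) → Continuous ψ' → (∀ z ∉ I, ψ z = 0) →
    ∫ z in I, (η' z : ℂ) * ψ z = -∫ z in I, (η z : ℂ) * ψ' z

variable [IsFiniteMeasure (volume.restrict I)]

/-- Vertical weak derivative of a separated product. -/
theorem integral_profile_deriv {η η' : ℝ → ℝ} (hη : Measurable η)
    (hη' : Measurable η') {C : ℝ} (hC : ∀ z, |η z| ≤ C) (hC' : ∀ z, |η' z| ≤ C)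
    (hd : HasProfileDeriv I η η') {w : (Fin 2 → ℝ) → ℂ} (hw : MemL2 S w)
    (hφ : IsTest (cyl S I) φ) :
    ∫ x in cyl S I, (η' (x 2) : ℂ) * w (proj x) * φ x
      = -∫ x in cyl S I, (η (x 2) : ℂ) * w (proj x) * pd 2 φ x := by
  rw [setIntegral_cyl_symm (integrable_mul_of_memLp (memL2_mul_comp_proj hη' hC' hw)
      (hφ.memLp _)), setIntegral_cyl_symm (integrable_mul_of_memLp (memL2_mul_comp_proj hη hC hw)
      ((hφ.pd 2).memLp _)), ← integral_neg]
  refine integral_congr_ae (Eventually.of_forall fun y => ?_)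
  simp only [ins_two, proj_ins, mul_comm _ (w y), mul_assoc, integral_const_mul]
  rw [hd _ _ (fun z => hφ.hasDerivAt_ins z y), mul_neg]
  · exact (hφ.pd 2).smooth.continuous.comp
      (continuous_iff_continuousAt.2 fun z => (hasDerivAt_ins z y).continuousAt)
  · intro z hz
    by_contra h
    exact hz (mem_cyl.1 (hφ.supp (subset_tsupport φ h))).1

theorem hasProfileDeriv_one (a b : ℝ) :
    HasProfileDeriv (Ioo a b) (fun _ => 1) (fun _ => 0) := by
  intro ψ ψ' hd hc h0
  rcases lt_or_ge a b with hab | hab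
  · rw [← integral_Ioc_eq_integral_Ioo, ← integral_Ioc_eq_integral_Ioo,
      ← intervalIntegral.integral_of_le hab.le, ← intervalIntegral.integral_of_le hab.le]
    simp only [Complex.ofReal_one, one_mul]
    rw [intervalIntegral.integral_eq_sub_of_hasDerivAt (fun z _ => hd z)
      (hc.intervalIntegrable _ _), h0 a (by simp), h0 b (by simp)]
    simp
  · simp [Ioo_eq_empty_of_le hab]

/-- The extension of a function to a cylinder, constant in the vertical direction, has the extended
gradient with vertical component zero. -/
theorem MemH1.comp_proj {a b : ℝ} {f : (Fin 2 → ℝ) → ℂ}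
    {g : (Fin 2 → ℝ) → Fin 2 → ℂ} (h : MemH1 S f g) :
    MemH1 (cyl S (Ioo a b)) (fun x => f (proj x))
      (liftField g) where
  memL2 := memL2_comp_proj h.memL2
  grad_memL2 := by
    refine memLp_pi_iff.2 fun i => ?_
    fin_cases i
    · exact memL2_comp_proj (h.grad_memL2.eval 0)
    · exact memL2_comp_proj (h.grad_memL2.eval 1)
    · exact MemLp.zero'
  weak φ hφ i := by
    have hor : ∀ i : Fin 2, ∫ x in cyl S (Ioo a b), g (proj x) i * φ x
        = -∫ x in cyl S (Ioo a b), f (proj x) * pd i.castSucc φ x := by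
      intro i
      rw [setIntegral_cyl (integrable_mul_of_memLp (memL2_comp_proj (h.grad_memL2.eval i))
          (hφ.memLp _)), setIntegral_cyl (integrable_mul_of_memLp (memL2_comp_proj h.memL2)
          ((hφ.pd _).memLp _)), ← integral_neg]
      refine integral_congr_ae (Eventually.of_forall fun z => ?_)
      simp only [proj_ins]
      rw [h.weak _ (hφ.comp_ins z) i]
      simp only [hφ.pd_ins]
    fin_cases i
    · exact hor 0
    · exact hor 1
    · have := integral_profile_deriv (C := 1) measurable_const measurable_const (by simp)
        (by simp) (hasProfileDeriv_one a b) h.memL2 hφ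
      simpa [liftField] using this

/-- The curl of a horizontal field `η(z) v(x, y)`. -/
theorem MemHCurl2D.profile_mul {η η' : ℝ → ℝ} (hη : Measurable η)
    (hη' : Measurable η') {C : ℝ} (hC : ∀ z, |η z| ≤ C) (hC' : ∀ z, |η' z| ≤ C)
    (hd : HasProfileDeriv I η η') {v : (Fin 2 → ℝ) → Fin 2 → ℂ} {c : (Fin 2 → ℝ) → ℂ}
    (h : MemHCurl2D S v c) :
    MemHCurl (cyl S I) (fun x => ![η (x 2) * v (proj x) 0, η (x 2) * v (proj x) 1, 0])
      (fun x => ![-(η' (x 2) * v (proj x) 1), η' (x 2) * v (proj x) 0,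
        η (x 2) * c (proj x)]) where
  memL2 := by
    refine memLp_pi_iff.2 fun i => ?_
    fin_cases i
    · exact memL2_mul_comp_proj hη hC (h.memL2.eval 0)
    · exact memL2_mul_comp_proj hη hC (h.memL2.eval 1)
    · exact MemLp.zero'
  curl_memL2 := by
    refine memLp_pi_iff.2 fun i => ?_
    fin_cases i
    · exact (memL2_mul_comp_proj hη' hC' (h.memL2.eval 1)).neg
    · exact memL2_mul_comp_proj hη' hC' (h.memL2.eval 0)
    · exact memL2_mul_comp_proj hη hC h.curl_memL2
  weak φ hφ := by
    have hm := fun i => memL2_mul_comp_proj (I := I) hη hC (h.memL2.eval i)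
    have hm' := fun i => memL2_mul_comp_proj (I := I) hη' hC' (h.memL2.eval i)
    have hc := memL2_mul_comp_proj (I := I) hη hC h.curl_memL2
    have ht := fun i => (hφ.eval i).memLp (cyl S I)
    have hp := fun i j => ((hφ.eval i).pd j).memLp (cyl S I)
    have hv := fun i j => integral_profile_deriv hη hη' hC hC' hd (h.memL2.eval i) (hφ.eval j)
    have isub : ∀ {f g : (Fin 3 → ℝ) → ℂ}, IntegrableOn f (cyl S I) → IntegrableOn g (cyl S I) →
        IntegrableOn (fun x => f x - g x) (cyl S I) := fun hf hg => hf.sub hg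
    have hor : ∫ x in cyl S I, (η (x 2) : ℂ) * c (proj x) * φ x 2
        = ∫ x in cyl S I, ((η (x 2) : ℂ) * v (proj x) 0 * pd 1 (fun y => φ y 2) x
          - (η (x 2) : ℂ) * v (proj x) 1 * pd 0 (fun y => φ y 2) x) := by
      rw [setIntegral_cyl (integrable_mul_of_memLp hc (ht 2)),
        setIntegral_cyl (isub (integrable_mul_of_memLp (hm 0) (hp 2 1))
          (integrable_mul_of_memLp (hm 1) (hp 2 0)))]
      refine integral_congr_ae (Eventually.of_forall fun z => ?_)
      simp only [ins_two, proj_ins, mul_assoc, ← mul_sub, integral_const_mul]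
      rw [h.weak _ ((hφ.eval 2).comp_ins z)]
      simp only [(hφ.eval 2).pd_ins]
      rfl
    have e1 : ∀ x, (![-((η' (x 2) : ℂ) * v (proj x) 1), η' (x 2) * v (proj x) 0,
        η (x 2) * c (proj x)] : Fin 3 → ℂ) ⬝ᵥ φ x
        = η' (x 2) * v (proj x) 0 * φ x 1 - η' (x 2) * v (proj x) 1 * φ x 0
          + η (x 2) * c (proj x) * φ x 2 := by
      intro x
      simp [dotProduct, Fin.sum_univ_three]
      ring
    have e2 : ∀ x, (![(η (x 2) : ℂ) * v (proj x) 0, η (x 2) * v (proj x) 1, 0] : Fin 3 → ℂ)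
        ⬝ᵥ curl φ x
        = η (x 2) * v (proj x) 1 * pd 2 (fun y => φ y 0) x
          - η (x 2) * v (proj x) 0 * pd 2 (fun y => φ y 1) x
          + (η (x 2) * v (proj x) 0 * pd 1 (fun y => φ y 2) x
            - η (x 2) * v (proj x) 1 * pd 0 (fun y => φ y 2) x) := by
      intro x
      simp [dotProduct, Fin.sum_univ_three, curl]
      ring
    simp only [e1, e2]
    have i1 := fun i j => integrable_mul_of_memLp (hm' i) (ht j)
    have i2 := fun i j k => integrable_mul_of_memLp (hm i) (hp j k)
    rw [integral_add (isub (i1 0 1) (i1 1 0)) (integrable_mul_of_memLp hc (ht 2)),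
      integral_sub (i1 0 1) (i1 1 0),
      integral_add (isub (i2 1 0 2) (i2 0 1 2)) (isub (i2 0 2 1) (i2 1 2 0)),
      integral_sub (i2 1 0 2) (i2 0 1 2), hor, hv 0 1, hv 1 0]
    ring

end Fubini

/-! ### The shape function -/

section Phi2

variable {d : ℝ}

theorem phi2_of_le {z : ℝ} (hz : |z| ≤ d / 2) :
    phi2 d z = 1 / 2 * √(3 / 2) * ((2 * z / d) ^ 2 - 1) := if_pos hz

theorem phi2_of_ge (hd : 0 < d) {z : ℝ} (hz : d / 2 ≤ |z|) : phi2 d z = 0 := by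
  rcases hz.eq_or_lt with h | h
  · have : (2 * z / d) ^ 2 = 1 := by
      rw [div_pow, mul_pow, ← sq_abs z, ← h]
      field_simp
    simp [phi2, this]
  · exact if_neg h.not_ge

theorem phi2_sq_le_one (hd : 0 < d) {z : ℝ} (hz : |z| ≤ d / 2) : (2 * z / d) ^ 2 ≤ 1 := by
  rw [sq_le_one_iff_abs_le_one, abs_div, abs_mul, abs_two, abs_of_pos hd, div_le_one hd]
  linarith

theorem phi2_nonpos (hd : 0 < d) (z : ℝ) : phi2 d z ≤ 0 := by
  rcases le_total |z| (d / 2) with h | h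
  · rw [phi2_of_le h]
    exact mul_nonpos_of_nonneg_of_nonpos (by positivity) (by linarith [phi2_sq_le_one hd h])
  · exact (phi2_of_ge hd h).le

theorem abs_phi2_le (hd : 0 < d) (z : ℝ) : |phi2 d z| ≤ 1 / 2 * √(3 / 2) := by
  rcases le_total |z| (d / 2) with h | h
  · rw [phi2_of_le h, abs_mul, abs_of_nonneg (by positivity : (0 : ℝ) ≤ 1 / 2 * √(3 / 2))]
    refine mul_le_of_le_one_right (by positivity) (abs_le.2 ⟨?_, ?_⟩)
    · linarith [sq_nonneg (2 * z / d)]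
    · linarith [phi2_sq_le_one hd h]
  · rw [phi2_of_ge hd h, abs_zero]
    positivity

theorem measurable_phi2 (d : ℝ) : Measurable (phi2 d) :=
  Measurable.ite (measurableSet_le (by fun_prop) measurable_const) (by fun_prop) measurable_const

theorem hasDerivAt_phi2_poly (d z : ℝ) :
    HasDerivAt (fun z : ℝ => 1 / 2 * √(3 / 2) * ((2 * z / d) ^ 2 - 1))
      (1 / 2 * √(3 / 2) * (2 * (2 * z / d) * (2 / d))) z := by
  have h : HasDerivAt (fun z : ℝ => 2 * z / d) (2 / d) z := by
    simpa using ((hasDerivAt_id z).const_mul 2).div_const d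
  simpa using ((h.pow 2).sub_const 1).const_mul (1 / 2 * √(3 / 2))

theorem deriv_phi2_of_lt {z : ℝ} (hz : |z| < d / 2) :
    deriv (phi2 d) z = 1 / 2 * √(3 / 2) * (2 * (2 * z / d) * (2 / d)) := by
  refine ((hasDerivAt_phi2_poly d z).congr_of_eventuallyEq ?_).deriv
  filter_upwards [(isOpen_lt continuous_abs continuous_const).mem_nhds hz] with y hy
  exact phi2_of_le (le_of_lt hy)

/-- Outside of the open sheet every point is a local maximum of the shape function, the kinks at the
two surfaces included; there `deriv` takes its junk value, which is zero as well. -/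
theorem deriv_phi2_of_ge (hd : 0 < d) {z : ℝ} (hz : d / 2 ≤ |z|) : deriv (phi2 d) z = 0 := by
  refine IsLocalMax.deriv_eq_zero (Eventually.of_forall fun y => ?_)
  rw [phi2_of_ge hd hz]
  exact phi2_nonpos hd y

theorem abs_deriv_phi2_le (hd : 0 < d) (z : ℝ) :
    |deriv (phi2 d) z| ≤ 1 / 2 * √(3 / 2) * (2 * (2 / d)) := by
  rcases lt_or_ge |z| (d / 2) with h | h
  · have h1 : |2 * z / d| ≤ 1 := (sq_le_one_iff_abs_le_one _).1 (phi2_sq_le_one hd h.le)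
    rw [deriv_phi2_of_lt h, abs_mul, abs_mul (2 * (2 * z / d)), abs_mul 2,
      abs_of_nonneg (by positivity : (0 : ℝ) ≤ 1 / 2 * √(3 / 2)), abs_two,
      abs_of_pos (by positivity : (0 : ℝ) < 2 / d)]
    gcongr
    linarith
  · rw [deriv_phi2_of_ge hd h, abs_zero]
    positivity

/-- The shape function is weakly differentiable on every interval containing the sheet, since it
vanishes at the two surfaces of the sheet. -/
theorem hasProfileDeriv_phi2 (hd : 0 < d) {a b : ℝ} (ha : a ≤ -(d / 2)) (hb : d / 2 ≤ b) :
    HasProfileDeriv (Ioo a b) (phi2 d) (deriv (phi2 d)) := by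
  intro ψ ψ' hψ hc _
  have hJ : Ioo (-(d / 2)) (d / 2) ⊆ Ioo a b := Ioo_subset_Ioo ha hb
  have hout : ∀ z ∈ Ioo a b \ Ioo (-(d / 2)) (d / 2), d / 2 ≤ |z| := fun z hz => by
    by_contra h
    exact hz.2 (abs_lt.1 (not_le.1 h))
  rw [setIntegral_eq_of_subset_of_forall_sdiff_eq_zero measurableSet_Ioo hJ
      (fun z hz => by simp [deriv_phi2_of_ge hd (hout z hz)]),
    setIntegral_eq_of_subset_of_forall_sdiff_eq_zero measurableSet_Ioo hJ
      (fun z hz => by simp [phi2_of_ge hd (hout z hz)])]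
  have e1 : ∫ z in Ioo (-(d / 2)) (d / 2), ((deriv (phi2 d) z : ℝ) : ℂ) * ψ z
      = ∫ z in Ioo (-(d / 2)) (d / 2),
        ((1 / 2 * √(3 / 2) * (2 * (2 * z / d) * (2 / d)) : ℝ) : ℂ) * ψ z :=
    setIntegral_congr_fun measurableSet_Ioo
      fun z hz => by simp only [deriv_phi2_of_lt (abs_lt.2 hz)]
  have e2 : ∫ z in Ioo (-(d / 2)) (d / 2), (phi2 d z : ℂ) * ψ' z
      = ∫ z in Ioo (-(d / 2)) (d / 2),
        ((1 / 2 * √(3 / 2) * ((2 * z / d) ^ 2 - 1) : ℝ) : ℂ) * ψ' z :=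
    setIntegral_congr_fun measurableSet_Ioo
      fun z hz => by simp only [phi2_of_le (abs_lt.2 hz).le]
  rw [e1, e2, ← integral_Ioc_eq_integral_Ioo, ← integral_Ioc_eq_integral_Ioo,
    ← intervalIntegral.integral_of_le (by linarith),
    ← intervalIntegral.integral_of_le (by linarith)]
  rw [intervalIntegral.integral_mul_deriv_eq_deriv_mul
    (u := fun z : ℝ => ((1 / 2 * √(3 / 2) * ((2 * z / d) ^ 2 - 1) : ℝ) : ℂ))
    (fun z _ => (hasDerivAt_phi2_poly d z).ofReal_comp) (fun z _ => hψ z)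
    (Continuous.intervalIntegrable (by fun_prop) _ _) (hc.intervalIntegrable _ _)]
  have h2 : 2 * (d / 2) / d = 1 := by field_simp
  have h3 : 2 * (-(d / 2)) / d = -1 := by field_simp
  simp only [h2, h3]
  simp

end Phi2

/-! ### The sheet -/

theorem Geometry.Ω_eq_cyl (G : Geometry) :
    G.Ω = cyl G.Ω2D (Ioo (-(G.dFe / 2) - G.dBelow) (G.dFe / 2 + G.dAbove)) :=
  Set.ext fun _ => and_comm

theorem isOpen_preimage_proj_inter {S : Set (Fin 2 → ℝ)} (hS : IsOpen S) (a b : ℝ) :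
    IsOpen {x : Fin 3 → ℝ | proj x ∈ S ∧ x 2 ∈ Ioo a b} :=
  (hS.preimage continuous_proj).inter (isOpen_Ioo.preimage (continuous_apply 2))

theorem Geometry.isOpen_Ω (G : Geometry) : IsOpen G.Ω :=
  isOpen_preimage_proj_inter G.isOpen_Ω2D _ _

theorem Geometry.isOpen_Ωc (G : Geometry) : IsOpen G.Ωc :=
  isOpen_preimage_proj_inter G.isOpen_Ω2Dc _ _

theorem Geometry.Ωc_subset (G : Geometry) : G.Ωc ⊆ G.Ω := fun _ hx =>
  ⟨G.subset hx.1, Ioo_subset_Ioo (by linarith [G.dBelow_nonneg]) (by linarith [G.dAbove_nonneg])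
    hx.2⟩

theorem Geometry.isBounded_Ω (G : Geometry) : Bornology.IsBounded G.Ω := by
  have hm : G.Ω = (fun p : ℝ × (Fin 2 → ℝ) => ins p.1 p.2) ''
      (Ioo (-(G.dFe / 2) - G.dBelow) (G.dFe / 2 + G.dAbove) ×ˢ G.Ω2D) := by
    ext x
    constructor
    · exact fun hx => ⟨split x, ⟨hx.2, hx.1⟩, ins_split x⟩
    · rintro ⟨p, hp, rfl⟩
      exact ⟨by simpa using hp.2, hp.1⟩
  have hb : Bornology.IsBounded (Ioo (-(G.dFe / 2) - G.dBelow) (G.dFe / 2 + G.dAbove) ×ˢ G.Ω2D) :=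
    (Metric.isBounded_Ioo _ _).prod G.isBounded_Ω2D
  obtain ⟨R, hR⟩ := isBounded_iff_forall_norm_le.1 hb
  rw [hm, isBounded_iff_forall_norm_le]
  refine ⟨R, ?_⟩
  rintro _ ⟨p, hp, rfl⟩
  have hp' := hR p hp
  refine (pi_norm_le_iff_of_nonneg ((norm_nonneg _).trans hp')).2 fun i => ?_
  fin_cases i
  · exact (norm_le_pi_norm p.2 0).trans ((norm_snd_le p).trans hp')
  · exact (norm_le_pi_norm p.2 1).trans ((norm_snd_le p).trans hp')
  · exact (norm_fst_le p).trans hp'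

/-- The part `φ₂(z) T₂(x, y)` of the ansatz. -/
noncomputable def phi2Field (d : ℝ) (T2 : (Fin 2 → ℝ) → Fin 2 → ℂ) (x : Fin 3 → ℝ) : Fin 3 → ℂ :=
  ![phi2 d (x 2) * T2 (proj x) 0, phi2 d (x 2) * T2 (proj x) 1, 0]

theorem msfemField_eq (d : ℝ) (T0 T2 : (Fin 2 → ℝ) → Fin 2 → ℂ) (x : Fin 3 → ℝ) :
    msfemField d T0 T2 x = liftField T0 x + phi2Field d T2 x := by
  ext i
  fin_cases i <;> simp [msfemField, liftField, phi2Field, phi0]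

/-- The part `φ₂ T₂` of the ansatz is an admissible current vector potential of the sheet. -/
theorem memHCurlCond_phi2Field (G : Geometry) {T2 : (Fin 2 → ℝ) → Fin 2 → ℂ}
    {c2 : (Fin 2 → ℝ) → ℂ} (h : MemHCurl2DCond G.Ω2D G.Ω2Dc T2 c2) :
    MemHCurlCond G.Ω G.Ωc (phi2Field G.dFe T2) (msfemCurl G.dFe T2 c2) := by
  have hd := G.dFe_pos
  have hm2 : MeasurableSet (G.Ω2D \ G.Ω2Dc) :=
    G.isOpen_Ω2D.measurableSet.diff G.isOpen_Ω2Dc.measurableSet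
  have hm3 : MeasurableSet (G.Ω \ G.Ωc) := G.isOpen_Ω.measurableSet.diff G.isOpen_Ωc.measurableSet
  -- outside of the sheet, the point is above or below it, or its projection is outside of `Ω2Dc`
  have hcases : ∀ x ∈ G.Ω \ G.Ωc, G.dFe / 2 ≤ |x 2| ∨ proj x ∈ G.Ω2D \ G.Ω2Dc := by
    rintro x ⟨hx, hxc⟩
    refine or_iff_not_imp_left.2 fun h => ⟨hx.1, fun h' => hxc ⟨h', abs_lt.1 (not_le.1 h)⟩⟩
  refine ⟨?_, ?_, ?_⟩
  · rw [G.Ω_eq_cyl]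
    refine MemHCurl2D.profile_mul (C := max (1 / 2 * √(3 / 2)) (1 / 2 * √(3 / 2) *
      (2 * (2 / G.dFe)))) (measurable_phi2 _) (measurable_deriv _)
      (fun z => le_max_of_le_left (abs_phi2_le hd z))
      (fun z => le_max_of_le_right (abs_deriv_phi2_le hd z))
      (hasProfileDeriv_phi2 hd (by linarith [G.dBelow_nonneg]) (by linarith [G.dAbove_nonneg]))
      h.memHCurl
  · refine (ae_restrict_iff' hm3).2 ?_
    filter_upwards [ae_proj ((ae_restrict_iff' hm2).1 h.vanish)] with x hx hxU
    rcases hcases x hxU with hz | hp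
    · ext i
      fin_cases i <;> simp [phi2Field, phi2_of_ge hd hz]
    · ext i
      fin_cases i <;> simp [phi2Field, hx hp]
  · refine (ae_restrict_iff' hm3).2 ?_
    filter_upwards [ae_proj ((ae_restrict_iff' hm2).1 h.vanish),
      ae_proj ((ae_restrict_iff' hm2).1 h.curl_vanish)] with x hx hx' hxU
    rcases hcases x hxU with hz | hp
    · ext i
      fin_cases i <;> simp [msfemCurl, phi2_of_ge hd hz, deriv_phi2_of_ge hd hz]
    · ext i
      fin_cases i <;> simp [msfemCurl, hx hp, hx' hp]

/-- The extension of `Φ₀` to the domain, constant in the vertical direction. -/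
theorem memH1_comp_proj (G : Geometry) {Φ0 : (Fin 2 → ℝ) → ℂ} {T0 : (Fin 2 → ℝ) → Fin 2 → ℂ}
    (h : MemH1 G.Ω2D Φ0 T0) :
    MemH1 G.Ω (fun x => Φ0 (proj x)) (liftField T0) := by
  rw [G.Ω_eq_cyl]
  exact h.comp_proj

theorem memHCurl_msfemField (G : Geometry) {Φ0 : (Fin 2 → ℝ) → ℂ}
    {T0 T2 : (Fin 2 → ℝ) → Fin 2 → ℂ} {c2 : (Fin 2 → ℝ) → ℂ} (h0 : MemH1 G.Ω2D Φ0 T0)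
    (h2 : MemHCurl2DCond G.Ω2D G.Ω2Dc T2 c2) :
    MemHCurl G.Ω (msfemField G.dFe T0 T2) (msfemCurl G.dFe T2 c2) := by
  have := (memH1_comp_proj G h0).memHCurl_grad.add (memHCurlCond_phi2Field G h2).memHCurl
  simp only [zero_add] at this
  rwa [funext (msfemField_eq G.dFe T0 T2)]

/-! ### Orthogonality of the two errors -/

/-- Pythagoras' theorem for the `ρ`-norm. -/
theorem Material.normSq_add {G : Geometry} (M : Material G) {A B : (Fin 3 → ℝ) → Fin 3 → ℂ}
    (hA : MemL2 G.Ωc A) (hB : MemL2 G.Ωc B)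
    (h : (∫ x in G.Ωc, (((M.σ x)⁻¹ : ℝ) : ℂ) * (B x ⬝ᵥ star (A x))).re = 0) :
    M.normSq (fun x => A x + B x) = M.normSq A + M.normSq B := by
  obtain ⟨a, b, ha, hab⟩ := M.σ_bounds
  have hm := G.isOpen_Ωc.measurableSet
  have hint : ∀ {u w : (Fin 3 → ℝ) → Fin 3 → ℂ}, MemL2 G.Ωc u → MemL2 G.Ωc w →
      IntegrableOn (fun x => (((M.σ x)⁻¹ : ℝ) : ℂ) * (u x ⬝ᵥ star (w x))) G.Ωc := by
    intro u w hu hw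
    have := integrable_dotProduct (memLp_ofReal_smul (C := a⁻¹)
      M.measurable_σ.inv.aestronglyMeasurable ?_ hu) (memLp_star hw)
    · simpa only [smul_dotProduct, smul_eq_mul] using! this
    · filter_upwards [ae_restrict_mem hm] with x hx
      have := (hab x hx).1
      rw [Pi.inv_apply, abs_of_nonneg (inv_nonneg.2 (ha.le.trans this))]
      exact inv_anti₀ ha this
  have hsq : ∀ (u : Fin 3 → ℂ) (r : ℝ), r * ∑ i, ‖u i‖ ^ 2 = ((r : ℂ) * (u ⬝ᵥ star u)).re := by
    intro u r
    rw [Complex.re_ofReal_mul]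
    congr 1
    simp only [dotProduct, Pi.star_apply, Complex.re_sum]
    refine Finset.sum_congr rfl fun i _ => ?_
    rw [Complex.star_def, Complex.mul_conj, Complex.normSq_eq_norm_sq, Complex.ofReal_re]
  have hcross : ∀ (u w : Fin 3 → ℂ) (r : ℝ), ((r : ℂ) * ((u + w) ⬝ᵥ star (u + w))).re
      = ((r : ℂ) * (u ⬝ᵥ star u)).re + ((r : ℂ) * (w ⬝ᵥ star w)).re
        + 2 * ((r : ℂ) * (w ⬝ᵥ star u)).re := by
    intro u w r
    simp only [Complex.re_ofReal_mul, dotProduct, Fin.sum_univ_three]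
    simp
    ring
  simp only [Material.normSq, hsq, ← Pi.add_apply]
  simp only [Pi.add_apply, hcross]
  have hre : ∀ f : (Fin 3 → ℝ) → ℂ, IntegrableOn f G.Ωc →
      IntegrableOn (fun x => (f x).re) G.Ωc := fun f hf => hf.re
  have hBA : ∫ x in G.Ωc, ((((M.σ x)⁻¹ : ℝ) : ℂ) * (B x ⬝ᵥ star (A x))).re = 0 :=
    (integral_re (hint hB hA)).trans h
  have hadd : IntegrableOn (fun x => ((((M.σ x)⁻¹ : ℝ) : ℂ) * (A x ⬝ᵥ star (A x))).re
      + ((((M.σ x)⁻¹ : ℝ) : ℂ) * (B x ⬝ᵥ star (B x))).re) G.Ωc :=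
    (hre _ (hint hA hA)).add (hre _ (hint hB hB))
  rw [integral_add hadd
      ((hre _ (hint hB hA)).const_mul 2), integral_add (hre _ (hint hA hA)) (hre _ (hint hB hB)),
    integral_const_mul, hBA, mul_zero, add_zero]

theorem Material.normSq_nonneg {G : Geometry} (M : Material G) (A : (Fin 3 → ℝ) → Fin 3 → ℂ) :
    0 ≤ M.normSq A := by
  obtain ⟨a, b, ha, hab⟩ := M.σ_bounds
  refine setIntegral_nonneg G.isOpen_Ωc.measurableSet fun x hx => ?_
  have : 0 < M.σ x := ha.trans_le (hab x hx).1
  positivity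

/-- The error identity tested with `conj (T - φ₂ T₂)` and `conj (Φ + Φ₀)`: the right-hand side is
purely imaginary. -/
theorem integral_error_dotProduct {G : Geometry} {M : Material G} {ω : ℝ}
    {HBS T J : (Fin 3 → ℝ) → Fin 3 → ℂ} {Φ : (Fin 3 → ℝ) → ℂ} {gΦ : (Fin 3 → ℝ) → Fin 3 → ℂ}
    (hHBS : MemL2 G.Ω HBS) (hT : IsEddyCurrentSolution M ω HBS T J Φ gΦ)
    {Φ0 : (Fin 2 → ℝ) → ℂ} {T0 : (Fin 2 → ℝ) → Fin 2 → ℂ} (hT0 : MemH1 G.Ω2D Φ0 T0)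
    {T2 : (Fin 2 → ℝ) → Fin 2 → ℂ} {c2 : (Fin 2 → ℝ) → ℂ}
    (hT2 : MemHCurl2DCond G.Ω2D G.Ω2Dc T2 c2) {γ : (Fin 3 → ℝ) → Fin 3 → ℂ}
    (hγ : IsEquilibratedFlux M ω HBS (msfemField G.dFe T0 T2) γ) :
    ∃ r : ℝ, (∫ x in G.Ωc, γ x ⬝ᵥ star (J x - msfemCurl G.dFe T2 c2 x))
      - ∫ x in G.Ωc, ((M.σ x)⁻¹ : ℂ) * (J x ⬝ᵥ star (J x - msfemCurl G.dFe T2 c2 x))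
      = Complex.I * r := by
  have hD := hT.memT.sub (memHCurlCond_phi2Field G hT2)
  have hv := hD.star
  have hg := hT.memΦ.add (memH1_comp_proj G hT0)
  have hq := hg.star
  -- `e` is the total error of the magnetic field, the test field is its conjugate
  set e : (Fin 3 → ℝ) → Fin 3 → ℂ :=
    fun x => (T x - phi2Field G.dFe T2 x) - (gΦ x + liftField T0 x) with he
  have he2 : MemL2 G.Ω e := hD.memHCurl.memL2.sub hg.grad_memL2
  have hTh : MemL2 G.Ω (msfemField G.dFe T0 T2) := (memHCurl_msfemField G hT0 hT2).memL2
  have heq : ∀ x, e x = T x - gΦ x - msfemField G.dFe T0 T2 x := fun x => by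
    rw [msfemField_eq]
    simp only [he]
    abel
  have hstar : ∀ x, star (T x - phi2Field G.dFe T2 x) - star (gΦ x + liftField T0 x) = star (e x) :=
    fun x => (star_sub _ _).symm
  obtain ⟨b, hb⟩ := M.μ_bound
  have hμ : ∀ᵐ x ∂volume.restrict G.Ω, |M.μ x| ≤ b := by
    filter_upwards [ae_restrict_mem G.isOpen_Ω.measurableSet] with x hx
    rw [abs_of_pos (M.μ_pos x hx)]
    exact hb x hx
  have hint : ∀ {u : (Fin 3 → ℝ) → Fin 3 → ℂ}, MemL2 G.Ω u →
      IntegrableOn (fun x => Complex.I * ω * M.μ x * (u x ⬝ᵥ star (e x))) G.Ω := fun {u} hu => by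
    have := (integrable_dotProduct (memLp_ofReal_smul M.measurable_μ.aestronglyMeasurable hμ hu)
      (memLp_star he2)).const_mul (Complex.I * ω)
    simpa only [smul_dotProduct, smul_eq_mul, mul_assoc] using! this
  have hweak := hT.weak _ _ _ _ hv hq
  have hibp := hγ.tangential.integral_dotProduct_curl G.isOpen_Ω G.isBounded_Ω G.Ωc_subset
    hγ.memHCurl hv
  have horth := hγ.normal.integral_dotProduct_grad hq
  have hcv : ∫ x in G.Ω, γ x ⬝ᵥ star (J x - msfemCurl G.dFe T2 c2 x)
      = ∫ x in G.Ωc, γ x ⬝ᵥ star (J x - msfemCurl G.dFe T2 c2 x) := by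
    refine setIntegral_eq_of_subset_of_ae_sdiff_eq_zero
      G.isOpen_Ω.measurableSet.nullMeasurableSet G.Ωc_subset ?_
    refine (ae_restrict_iff' (G.isOpen_Ω.measurableSet.diff G.isOpen_Ωc.measurableSet)).1 ?_
    filter_upwards [hv.curl_vanish] with x hx
    rw [hx, dotProduct_zero]
  have hflux : ∫ x in G.Ω, fluxCurl M ω HBS (msfemField G.dFe T0 T2) x ⬝ᵥ
        star (T x - phi2Field G.dFe T2 x)
      = ∫ x in G.Ω, -(Complex.I * ω * M.μ x *
          ((msfemField G.dFe T0 T2 x + HBS x) ⬝ᵥ star (e x))) := by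
    rw [← sub_zero (∫ x in G.Ω, _ ⬝ᵥ star (T x - phi2Field G.dFe T2 x)), ← horth,
      ← integral_sub (integrable_dotProduct hγ.memHCurl.curl_memL2 hv.memHCurl.memL2)
        (integrable_dotProduct hγ.memHCurl.curl_memL2 hq.grad_memL2)]
    simp only [← dotProduct_sub, hstar]
    simp only [fluxCurl, smul_dotProduct, smul_eq_mul, neg_mul]
  have hsum := hint (hTh.add hHBS)
  simp only [Pi.add_apply] at hsum
  simp only [hstar] at hweak
  refine ⟨∫ x in G.Ω, ω * M.μ x * ∑ i, ‖e x i‖ ^ 2, ?_⟩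
  have hfin : ∫ x in G.Ω, Complex.I * ω * M.μ x * (e x ⬝ᵥ star (e x))
      = Complex.I * ((∫ x in G.Ω, ω * M.μ x * ∑ i, ‖e x i‖ ^ 2 : ℝ) : ℂ) := by
    rw [← integral_complex_ofReal, ← integral_const_mul]
    refine integral_congr_ae (Eventually.of_forall fun x => ?_)
    simp only [dotProduct, Pi.star_apply, Complex.star_def, Complex.mul_conj,
      Complex.normSq_eq_norm_sq]
    push_cast
    ring
  have hTg : MemL2 G.Ω fun x => T x - gΦ x := hT.memT.memHCurl.memL2.sub hT.memΦ.grad_memL2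
  have hsplit : ∫ x in G.Ω, Complex.I * ω * M.μ x * (e x ⬝ᵥ star (e x))
      = (∫ x in G.Ω, Complex.I * ω * M.μ x * ((T x - gΦ x) ⬝ᵥ star (e x)))
        + (∫ x in G.Ω, Complex.I * ω * M.μ x * (HBS x ⬝ᵥ star (e x)))
        - ∫ x in G.Ω, Complex.I * ω * M.μ x *
          ((msfemField G.dFe T0 T2 x + HBS x) ⬝ᵥ star (e x)) := by
    rw [← integral_add (hint hTg) (hint hHBS), ← integral_sub _ hsum]
    swap
    · exact (hint hTg).add (hint hHBS)
    refine integral_congr_ae (Eventually.of_forall fun x => ?_)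
    have : e x ⬝ᵥ star (e x) = (T x - gΦ x) ⬝ᵥ star (e x) + HBS x ⬝ᵥ star (e x)
        - (msfemField G.dFe T0 T2 x + HBS x) ⬝ᵥ star (e x) := by
      rw [← add_dotProduct, ← sub_dotProduct]
      congr 1
      rw [heq]
      abel
    simp only [this]
    ring
  rw [← hcv, hibp, hflux, integral_neg, ← hfin, hsplit]
  linear_combination -hweak

end EddyCurrent

theorem mainTheorem1 (G : EddyCurrent.Geometry) (M : EddyCurrent.Material G) (ω : ℝ)
    (HBS : (Fin 3 → ℝ) → Fin 3 → ℂ) (hHBS : EddyCurrent.MemL2 G.Ω HBS)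
    (T curlT : (Fin 3 → ℝ) → Fin 3 → ℂ)
    (Φ : (Fin 3 → ℝ) → ℂ) (gradΦ : (Fin 3 → ℝ) → Fin 3 → ℂ)
    (hT : EddyCurrent.IsEddyCurrentSolution M ω HBS T curlT Φ gradΦ)
    (Φ0 : (Fin 2 → ℝ) → ℂ) (T0 : (Fin 2 → ℝ) → Fin 2 → ℂ)
    (hT0 : EddyCurrent.MemH1 G.Ω2D Φ0 T0)
    (T2 : (Fin 2 → ℝ) → Fin 2 → ℂ) (curlT2 : (Fin 2 → ℝ) → ℂ)
    (hT2 : EddyCurrent.MemHCurl2DCond G.Ω2D G.Ω2Dc T2 curlT2)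
    (γ : (Fin 3 → ℝ) → Fin 3 → ℂ)
    (hγ : EddyCurrent.IsEquilibratedFlux M ω HBS (EddyCurrent.msfemField G.dFe T0 T2) γ) :
    EddyCurrent.MemHCurl G.Ω (EddyCurrent.msfemField G.dFe T0 T2)
        (EddyCurrent.msfemCurl G.dFe T2 curlT2) ∧
      M.normSq (fun x => curlT x - EddyCurrent.msfemCurl G.dFe T2 curlT2 x)
          + M.normSq (fun x => (M.σ x : ℂ) • γ x - curlT x)
        = M.normSq (fun x => (M.σ x : ℂ) • γ x - EddyCurrent.msfemCurl G.dFe T2 curlT2 x) ∧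
      M.normSq (fun x => curlT x - EddyCurrent.msfemCurl G.dFe T2 curlT2 x)
        ≤ M.normSq (fun x => (M.σ x : ℂ) • γ x - EddyCurrent.msfemCurl G.dFe T2 curlT2 x) := by
  open EddyCurrent in
  have hm := G.isOpen_Ωc.measurableSet
  have hTh := memHCurl_msfemField G hT0 hT2
  have hle : volume.restrict G.Ωc ≤ volume.restrict G.Ω := Measure.restrict_mono G.Ωc_subset le_rfl
  obtain ⟨a, b, ha, hab⟩ := M.σ_bounds
  have hσpos : ∀ x ∈ G.Ωc, 0 < M.σ x := fun x hx => ha.trans_le (hab x hx).1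
  have hγc : MemL2 G.Ωc γ := hγ.memHCurl.memL2.mono_measure hle
  have hJ : MemL2 G.Ωc curlT := hT.memT.memHCurl.curl_memL2.mono_measure hle
  have hA : MemL2 G.Ωc fun x => curlT x - msfemCurl G.dFe T2 curlT2 x :=
    hJ.sub (hTh.curl_memL2.mono_measure hle)
  have hσ : ∀ᵐ x ∂volume.restrict G.Ωc, |M.σ x| ≤ b := by
    filter_upwards [ae_restrict_mem hm] with x hx
    rw [abs_of_pos (hσpos x hx)]
    exact (hab x hx).2
  have hρ : ∀ᵐ x ∂volume.restrict G.Ωc, |(M.σ x)⁻¹| ≤ a⁻¹ := by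
    filter_upwards [ae_restrict_mem hm] with x hx
    rw [abs_of_pos (inv_pos.2 (hσpos x hx))]
    exact inv_anti₀ ha (hab x hx).1
  have hB : MemL2 G.Ωc fun x => (M.σ x : ℂ) • γ x - curlT x :=
    (memLp_ofReal_smul M.measurable_σ.aestronglyMeasurable hσ hγc).sub hJ
  have hortho : (∫ x in G.Ωc, (((M.σ x)⁻¹ : ℝ) : ℂ) * (((M.σ x : ℂ) • γ x - curlT x) ⬝ᵥ
      star (curlT x - msfemCurl G.dFe T2 curlT2 x))).re = 0 := by
    obtain ⟨r, hr⟩ := integral_error_dotProduct hHBS hT hT0 hT2 hγ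
    have hJA := integrable_dotProduct
      (memLp_ofReal_smul M.measurable_σ.inv.aestronglyMeasurable hρ hJ) (memLp_star hA)
    simp only [smul_dotProduct, smul_eq_mul, Pi.inv_apply, Complex.ofReal_inv] at hJA
    rw [← integral_sub (integrable_dotProduct hγc (memLp_star hA)) hJA] at hr
    rw [setIntegral_congr_fun hm (g := fun x => γ x ⬝ᵥ star (curlT x -
      msfemCurl G.dFe T2 curlT2 x) - ((M.σ x)⁻¹ : ℂ) * (curlT x ⬝ᵥ star (curlT x -
      msfemCurl G.dFe T2 curlT2 x))), hr]
    · simp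
    · intro x hx
      have h0 : (M.σ x : ℂ) ≠ 0 := by exact_mod_cast (hσpos x hx).ne'
      simp only [sub_dotProduct, smul_dotProduct, smul_eq_mul, Complex.ofReal_inv, mul_sub]
      rw [inv_mul_cancel_left₀ h0]
  have hpyth := M.normSq_add hA hB hortho
  simp only [sub_add_sub_cancel'] at hpyth
  refine ⟨hTh, hpyth.symm, ?_⟩
  rw [hpyth]
  exact le_add_of_nonneg_right (M.normSq_nonneg _)
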